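/- For integers $m,n>1$ let $K_{m\times n}$ be the complete multipartite graph with $m$ parts of size $n$, with vertex set $\mathbb{Z}_{mn}$ and with parts the cosets of the subgroup $m\mathbb{Z}_{mn}$; that is, $x$ and $y$ are adjacent if and only if $x-y\notin m\mathbb{Z}_{mn}$. A $2$-factor of a graph is a set of cycles of the graph whose vertex sets partition its vertex set. A $C_4$-factorization of a graph is a set $\mathcal{F}$ of $2$-factors, all of whose cycles have length $4$, such that every edge of the graph appears in exactly one member of $\mathcal{F}$. A $C_4$-factorization $\mathcal{F}$ of $K_{m\times n}$ is cyclic if $F+g\in\mathcal{F}$ for all $F\in\mathcal{F}$ and all $g\in\mathbb{Z}_{mn}$, where $F+g$ is the image of $F$ under $x\mapsto x+g$. Let $m>1$ be an odd integer. There exists a cyclic $C_4$-factorization of $K_{m\times 4}$ if and only if $m$ is not a prime power, i.e. $m\neq p^\alpha$ for every prime $p$ and every integer $\alpha\ge 1$. -/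

import Mathlib

namespace CyclicFactorization

section Factorizations

variable {V : Type*} {Γ : SimpleGraph V}

/-- The subgraph `C` of `Γ` is a cycle of length `ℓ`: it consists of the vertices and edges of a
closed walk that is a cycle with `ℓ` edges. -/
def IsCycleOfLength (C : Γ.Subgraph) (ℓ : ℕ) : Prop :=
  ∃ (u : V) (w : Γ.Walk u u), w.IsCycle ∧ w.length = ℓ ∧ w.toSubgraph = C

/-- A `2`-factor of `Γ`: a set of cycles of `Γ` whose vertex sets partition the vertices. -/
structure IsTwoFactor (F : Set Γ.Subgraph) : Prop where
  isCycle : ∀ C ∈ F, ∃ ℓ, IsCycleOfLength C ℓ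
  partition : ∀ v : V, ∃! C : Γ.Subgraph, C ∈ F ∧ v ∈ C.verts

/-- A `2`-factorization of `Γ`: a set of `2`-factors such that every edge of `Γ` appears in exactly
one of them. -/
structure IsTwoFactorization (𝓕 : Set (Set Γ.Subgraph)) : Prop where
  isTwoFactor : ∀ F ∈ 𝓕, IsTwoFactor F
  edge : ∀ e ∈ Γ.edgeSet, ∃! F : Set Γ.Subgraph, F ∈ 𝓕 ∧ ∃ C ∈ F, e ∈ C.edgeSet

/-- A `C_ℓ`-factorization: a `2`-factorization all of whose cycles have length `ℓ`. -/
structure IsCycleFactorization (𝓕 : Set (Set Γ.Subgraph)) (ℓ : ℕ) : Prop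
    extends IsTwoFactorization 𝓕 where
  length_eq : ∀ F ∈ 𝓕, ∀ C ∈ F, IsCycleOfLength C ℓ

end Factorizations

/-- The complete multipartite graph `K_{m × n}` with `m` parts of size `n`, as the Cayley graph of
`ℤ/mn` with connection set the complement of the subgroup generated by `m`; the parts are the
cosets of this subgroup. -/
def multipartite (m n : ℕ) : SimpleGraph (ZMod (m * n)) where
  Adj x y := x - y ∉ AddSubgroup.zmultiples (m : ZMod (m * n))
  symm := ⟨fun x y h h' => h (by simpa using neg_mem h')⟩
  loopless := ⟨fun x h => h (by simp)⟩

/-- The translation `x ↦ x + g`, as a homomorphism of `K_{m × n}` to itself. -/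
def translation (m n : ℕ) (g : ZMod (m * n)) : multipartite m n →g multipartite m n where
  toFun x := x + g
  map_rel' := by
    intro x y h
    simpa [multipartite] using h

/-- A set `𝓕` of sets of subgraphs of `K_{m × n}` is cyclic if `F + g ∈ 𝓕` for all `F ∈ 𝓕` and
all `g` in `ℤ/mn`, where `F + g` is the set of all translates `C + g` with `C ∈ F`. -/
def IsCyclicFamily {m n : ℕ} (𝓕 : Set (Set (multipartite m n).Subgraph)) : Prop :=
  ∀ F ∈ 𝓕, ∀ g : ZMod (m * n),
    (fun C : (multipartite m n).Subgraph => C.map (translation m n g)) '' F ∈ 𝓕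

end CyclicFactorization

/-! If `m = p ^ α`, take `x` of order `p` and the factor `F` containing the edge `{0, x}`, with
translation stabilizer `S`. The element `x` is not in `S`, since otherwise it would act without
fixed points on the four vertices of a cycle. The element `m`, of order 4, is not in `S` either: `F`
has `m` cycles, an odd number, so one would be fixed and be a whole part, which has no edges. In a
cyclic group this makes `|S|` prime to `p` and not divisible by 4, hence at most 2. Then `F` has at
least `2m` translates with two edges each at `0`, more than the degree `4m - 4`.

Otherwise `m = a * b` with coprime odd `1 < a < b`, and the group is `G = ℤ/4 × ℤ/a × ℤ/b`. A base
factor is a permutation `x ↦ x + δ (π x)`, where `π` is a map from `G` to a quotient `Q`; it is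
invariant under `ker π`, so its translates are indexed by `Q` (`exists_cyclic_of_differences`). The
translates of all base factors decompose the edges exactly when the values `± δ q` run once through
the elements with nonzero `ℤ/a × ℤ/b` component.

The base factors are `stepsB` with `Q = ℤ/2 × ℤ/b`, `stepsA` for `1 ≤ j ≤ (b - 1) / 2` with `Q = ℤ/2
× ℤ/a`, and `edgeSteps` with `Q = ℤ/2`. The first two supply all differences with even `ℤ/4`
component and some of the odd ones; `edgeSteps` fills in the remaining odd ones
(`coversPure_allSteps`, `coversMixed_allSteps`). Coverage and the count `card_index_eq` give
exactness. -/

namespace CyclicFactorization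

/-! ### Factors as orbits of permutations, and the reduction to differences. -/

section PermutationFamilies

variable {V : Type*} {Γ : SimpleGraph V}

/-- The subgraph formed by the orbit `x, σ x, σ (σ x), …` and the edges `{u, σ u}` on it. -/
def orbitSubgraph (σ : V → V) (hσ : ∀ x, Γ.Adj x (σ x)) (x : V) : Γ.Subgraph where
  verts := {v | ∃ n : ℕ, σ^[n] x = v}
  Adj u v := (∃ n : ℕ, σ^[n] x = u) ∧ (∃ n : ℕ, σ^[n] x = v) ∧ (σ u = v ∨ σ v = u)
  adj_sub := by
    rintro u v ⟨-, -, rfl | rfl⟩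
    exacts [hσ u, (hσ v).symm]
  edge_vert h := h.1
  symm := ⟨fun _ _ h => ⟨h.2.1, h.1, h.2.2.symm⟩⟩

variable {σ : V → V} (hσ : ∀ x, Γ.Adj x (σ x)) (h4 : ∀ x, σ (σ (σ (σ x))) = x)

include h4 in
theorem exists_iterate_eq_iff (x v : V) :
    (∃ n : ℕ, σ^[n] x = v) ↔ v = x ∨ v = σ x ∨ v = σ (σ x) ∨ v = σ (σ (σ x)) := by
  constructor
  · rintro ⟨n, rfl⟩
    induction n with
    | zero => simp
    | succ n ih =>
      rw [Function.iterate_succ_apply']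
      rcases ih with h | h | h | h <;> rw [h] <;> simp [h4]
  · rintro (rfl | rfl | rfl | rfl)
    exacts [⟨0, rfl⟩, ⟨1, rfl⟩, ⟨2, rfl⟩, ⟨3, rfl⟩]

include h4 in
theorem orbitSubgraph_apply (x : V) : orbitSubgraph σ hσ (σ x) = orbitSubgraph σ hσ x := by
  have key : ∀ v, (∃ n : ℕ, σ^[n] (σ x) = v) ↔ ∃ n : ℕ, σ^[n] x = v := by
    intro v
    rw [exists_iterate_eq_iff h4, exists_iterate_eq_iff h4, h4]
    tauto
  ext u v
  · exact key u
  · simp only [orbitSubgraph, key]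

include h4 in
theorem orbitSubgraph_eq_of_mem {x v : V} (h : v ∈ (orbitSubgraph σ hσ x).verts) :
    orbitSubgraph σ hσ v = orbitSubgraph σ hσ x := by
  rcases (exists_iterate_eq_iff h4 x v).1 h with rfl | rfl | rfl | rfl <;>
    simp only [orbitSubgraph_apply hσ h4]

include h4 in
theorem isCycleOfLength_orbitSubgraph (h2 : ∀ x, σ (σ x) ≠ x) (x : V) :
    IsCycleOfLength (orbitSubgraph σ hσ x) 4 := by
  have n1 : ∀ y, y ≠ σ y := fun y => (hσ y).ne
  have a3 : Γ.Adj (σ (σ (σ x))) x := by simpa [h4] using hσ (σ (σ (σ x)))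
  have n3 := a3.ne
  refine ⟨x, .cons (hσ x) (.cons (hσ (σ x)) (.cons (hσ (σ (σ x))) (.cons a3 .nil))), ?_, rfl, ?_⟩
  · have m1 := n1 x
    have m2 := n1 (σ x)
    have m3 := n1 (σ (σ x))
    have m4 := h2 x
    have m5 := h2 (σ x)
    rw [SimpleGraph.Walk.cons_isCycle_iff]
    simp only [SimpleGraph.Walk.cons_isPath_iff, SimpleGraph.Walk.support_cons,
      SimpleGraph.Walk.support_nil, SimpleGraph.Walk.edges_cons, SimpleGraph.Walk.edges_nil,
      List.mem_cons, List.not_mem_nil, Sym2.eq_iff]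
    grind [SimpleGraph.Walk.IsPath.nil]
  · have mem := exists_iterate_eq_iff h4 x
    ext u v
    · simp [orbitSubgraph, mem]
      tauto
    · simp only [orbitSubgraph, mem, SimpleGraph.Walk.toSubgraph, SimpleGraph.Subgraph.sup_adj,
        SimpleGraph.subgraphOfAdj_adj, SimpleGraph.singletonSubgraph_adj, Sym2.eq_iff,
        Pi.bot_apply, Prop.bot_eq_false]
      grind

end PermutationFamilies

/-- A family of permutations `σ i` of order `4`, moving every vertex along an edge, such that every
edge is `{u, σ i u}` for exactly one `i`, and closed under conjugation by translations, yields a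
cyclic `C₄`-factorization. -/
theorem exists_cyclic_of_permutations {m n : ℕ} {ι : Type*}
    (σ : ι → ZMod (m * n) → ZMod (m * n))
    (hσ : ∀ i x, (multipartite m n).Adj x (σ i x))
    (h4 : ∀ i x, σ i (σ i (σ i (σ i x))) = x) (h2 : ∀ i x, σ i (σ i x) ≠ x)
    (hedge : ∀ x y, (multipartite m n).Adj x y → ∃! i, σ i x = y ∨ σ i y = x)
    (htrans : ∀ i g, ∃ j, ∀ x, σ j (x + g) = σ i x + g) :
    ∃ 𝓕 : Set (Set (multipartite m n).Subgraph), IsCycleFactorization 𝓕 4 ∧ IsCyclicFamily 𝓕 := by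
  have hlen : ∀ i x, IsCycleOfLength (orbitSubgraph (σ i) (hσ i) x) 4 := fun i x =>
    isCycleOfLength_orbitSubgraph (hσ i) (h4 i) (h2 i) x
  refine ⟨Set.range fun i => Set.range (orbitSubgraph (σ i) (hσ i)), ⟨⟨?_, ?_⟩, ?_⟩, ?_⟩
  · rintro _ ⟨i, rfl⟩
    refine ⟨?_, fun v => ⟨orbitSubgraph (σ i) (hσ i) v, ⟨⟨v, rfl⟩, ⟨0, rfl⟩⟩, ?_⟩⟩
    · rintro _ ⟨x, rfl⟩
      exact ⟨4, hlen i x⟩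
    · rintro _ ⟨⟨x, rfl⟩, hx⟩
      exact (orbitSubgraph_eq_of_mem (hσ i) (h4 i) hx).symm
  · intro e he
    induction e using Sym2.ind with
    | _ x y =>
    obtain ⟨i, hi, hu⟩ := hedge x y he
    refine ⟨_, ⟨⟨i, rfl⟩, ?_⟩, ?_⟩
    · refine ⟨_, ⟨x, rfl⟩, ⟨0, rfl⟩, ?_, hi⟩
      rcases hi with rfl | rfl
      exacts [⟨1, rfl⟩, ⟨3, h4 i y⟩]
    · rintro _ ⟨⟨j, rfl⟩, _, ⟨z, rfl⟩, hz⟩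
      rw [hu j hz.2.2]
  · rintro _ ⟨i, rfl⟩ _ ⟨x, rfl⟩
    exact hlen i x
  · rintro _ ⟨i, rfl⟩ g
    obtain ⟨j, hj⟩ := htrans i g
    have hit : ∀ (k : ℕ) x, (σ j)^[k] (x + g) = (σ i)^[k] x + g := by
      intro k
      induction k with
      | zero => simp
      | succ k ih => intro x; rw [Function.iterate_succ_apply, hj, ih, Function.iterate_succ_apply]
    have hmap : ∀ x, (orbitSubgraph (σ i) (hσ i) x).map (translation m n g) =
        orbitSubgraph (σ j) (hσ j) (x + g) := by
      intro x
      ext u v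
      · simp [orbitSubgraph, translation, hit, eq_add_neg_iff_add_eq]
      · simp only [SimpleGraph.Subgraph.map, Relation.Map, orbitSubgraph, translation, hit]
        constructor
        · rintro ⟨u, v, ⟨⟨k, rfl⟩, ⟨l, rfl⟩, h⟩, rfl, rfl⟩
          refine ⟨⟨k, rfl⟩, ⟨l, rfl⟩, ?_⟩
          simpa [hj] using h
        · rintro ⟨⟨k, rfl⟩, ⟨l, rfl⟩, h⟩
          refine ⟨_, _, ⟨⟨k, rfl⟩, ⟨l, rfl⟩, ?_⟩, rfl, rfl⟩
          simpa [hj] using h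
    refine ⟨j, ?_⟩
    ext C
    constructor
    · rintro ⟨y, rfl⟩
      exact ⟨_, ⟨y - g, rfl⟩, by simp [hmap]⟩
    · rintro ⟨_, ⟨x, rfl⟩, rfl⟩
      exact ⟨x + g, (hmap x).symm⟩

/-- A finite `G`-set `T` with a map `δ : T → G` describing, for each `t`, the permutation
`x ↦ x + δ (x • t)`. If the steps close up after four rounds, and the differences `± δ t` cover each
of the connection elements as economically as possible, we get a cyclic `C₄`-factorization. -/
theorem exists_cyclic_of_differences {m n : ℕ} {G T : Type*} [AddCommGroup G] [Finite G] [Fintype T]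
    (e : G ≃+ ZMod (m * n)) (act : G → T → T) (act_zero : ∀ t, act 0 t = t)
    (act_add : ∀ x y t, act (x + y) t = act x (act y t)) (δ : T → G) (τ : T → T)
    (hτ : ∀ t, act (δ t) t = τ t)
    (hδ : ∀ t, e (δ t) ∉ AddSubgroup.zmultiples (m : ZMod (m * n)))
    (h4 : ∀ t, δ t + δ (τ t) + δ (τ (τ t)) + δ (τ (τ (τ t))) = 0)
    (h2 : ∀ t, δ t + δ (τ t) ≠ 0)
    (hcover : ∀ d, e d ∉ AddSubgroup.zmultiples (m : ZMod (m * n)) → ∃ t, δ t = d ∨ δ t = -d)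
    (hcard : 2 * Fintype.card T ≤
      Nat.card {d : G // e d ∉ AddSubgroup.zmultiples (m : ZMod (m * n))}) :
    ∃ 𝓕 : Set (Set (multipartite m n).Subgraph), IsCycleFactorization 𝓕 4 ∧ IsCyclicFamily 𝓕 := by
  set P := AddSubgroup.zmultiples (m : ZMod (m * n))
  let f : T ⊕ T → {d : G // e d ∉ P} :=
    Sum.elim (fun t => ⟨δ t, hδ t⟩) (fun t => ⟨-δ t, by simpa using hδ t⟩)
  have hsurj : Function.Surjective f := by
    rintro ⟨d, hd⟩
    obtain ⟨t, ht | ht⟩ := hcover d hd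
    exacts [⟨.inl t, Subtype.ext ht⟩, ⟨.inr t, Subtype.ext (by simp [f, ht])⟩]
  -- A surjection onto a set that is at least as large is bijective: each connection element is `δ
  -- t` or `-δ t` for one `t` and one sign only.
  have hinj : Function.Injective f := by
    refine (hsurj.bijective_of_nat_card_le ?_).1
    rw [Nat.card_eq_fintype_card, Fintype.card_sum]
    omega
  have inj1 : ∀ t t', δ t = δ t' → t = t' := fun t t' h =>
    Sum.inl_injective (hinj (a₁ := .inl t) (a₂ := .inl t') (Subtype.ext h))
  have inj2 : ∀ t t', δ t ≠ -δ t' := fun t t' h => by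
    simpa using hinj (a₁ := .inl t) (a₂ := .inr t') (Subtype.ext h)
  have act_inj : ∀ x t t', act x t = act x t' → t = t' := fun x t t' h => by
    rw [← act_zero t, ← act_zero t', ← neg_add_cancel x, act_add, act_add, h]
  let σ : T → ZMod (m * n) → ZMod (m * n) := fun t x => e (δ (act (e.symm x) t)) + x
  have step : ∀ t x, act (e.symm (σ t x)) t = τ (act (e.symm x) t) := fun t x => by
    simp only [σ, map_add, AddEquiv.symm_apply_apply, act_add, hτ]
  have σ_apply : ∀ t x, σ t x = e (δ (act (e.symm x) t)) + x := fun t x => rfl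
  refine exists_cyclic_of_permutations σ ?_ ?_ ?_ ?_ ?_
  · intro t x
    simpa [multipartite, σ] using hδ (act (e.symm x) t)
  · intro t x
    rw [σ_apply t (σ t (σ t (σ t x))), σ_apply t (σ t (σ t x)), σ_apply t (σ t x), step, step, step,
      σ_apply t x]
    have := congrArg e (h4 (act (e.symm x) t))
    simp only [map_add, map_zero] at this
    linear_combination this
  · intro t x h
    rw [σ_apply t (σ t x), step, σ_apply t x] at h
    refine h2 (act (e.symm x) t) (e.injective ?_)
    rw [map_add, map_zero]
    linear_combination h
  · have key : ∀ t x y, σ t x = y ↔ δ (act (e.symm x) t) = e.symm (y - x) := fun t x y => by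
      rw [← e.injective.eq_iff, AddEquiv.apply_symm_apply, eq_sub_iff_add_eq]
    have neg_symm : ∀ x y, e.symm (y - x) = -e.symm (x - y) := fun x y => by
      rw [← map_neg, neg_sub]
    intro x y hxy
    have hyx := hxy.symm
    obtain ⟨t, ht⟩ := hcover (e.symm (y - x)) (by simpa [multipartite] using hyx)
    have shift : ∀ z : G, act z (act (-z) t) = t := fun z => by
      rw [← act_add, add_neg_cancel, act_zero]
    refine existsUnique_of_exists_of_unique ?_ ?_
    -- The permutation with index `t` makes the step `δ t` at the vertex `0`; shifting the index by
    -- `-x` moves this step to the vertex `x`.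
    · rcases ht with ht | ht
      · exact ⟨act (-e.symm x) t, Or.inl ((key _ _ _).2 (by rw [shift, ht]))⟩
      · exact ⟨act (-e.symm y) t, Or.inr ((key _ _ _).2 (by rw [shift, ht, ← neg_symm]))⟩
    · rintro i j (hi | hi) (hj | hj) <;> rw [key] at hi hj
      · exact act_inj _ _ _ (inj1 _ _ (hi.trans hj.symm))
      · exact absurd (hi.trans ((neg_symm x y).trans (congrArg _ hj.symm))) (inj2 _ _)
      · exact absurd (hj.trans ((neg_symm x y).trans (congrArg _ hi.symm))) (inj2 _ _)
      · exact act_inj _ _ _ (inj1 _ _ (hi.trans hj.symm))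
  · intro t g
    refine ⟨act (-e.symm g) t, fun x => ?_⟩
    simp only [σ, ← act_add, map_add, add_neg_cancel, add_zero, add_assoc]

/-! ### Residues modulo an odd number, up to sign. -/

section HalfSystem

variable {n N : ℕ}

theorem exists_half_repr (hn : n = 2 * N + 1) (x : ZMod n) :
    x = 0 ∨ ∃ u : ℕ, 1 ≤ u ∧ u ≤ N ∧ (x = u ∨ x = -u) := by
  have : NeZero n := ⟨by omega⟩
  rcases eq_or_ne x 0 with rfl | hx
  · exact Or.inl rfl
  · have h0 : x.val ≠ 0 := by simpa using hx
    have hlt := x.val_lt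
    refine Or.inr ?_
    by_cases h : x.val ≤ N
    · exact ⟨x.val, by omega, h, Or.inl (by simp)⟩
    · refine ⟨n - x.val, by omega, by omega, Or.inr ?_⟩
      rw [Nat.cast_sub hlt.le]
      simp

theorem natCast_ne_zero_of_le (hn : n = 2 * N + 1) {u : ℕ} (h1 : 1 ≤ u) (h2 : u ≤ N) :
    (u : ZMod n) ≠ 0 := by
  rw [Ne, ZMod.natCast_eq_zero_iff]
  intro h
  have := Nat.le_of_dvd (by omega) h
  omega

theorem two_mul_ne_zero_of_odd (hn : n = 2 * N + 1) {x : ZMod n} (hx : x ≠ 0) : 2 * x ≠ 0 := by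
  intro h
  have hN : (2 * N + 1 : ZMod n) = 0 := by
    have := ZMod.natCast_self n
    rw [hn] at this ⊢
    exact_mod_cast this
  exact hx (by linear_combination (-(N : ZMod n)) * h + x * hN)

theorem ne_neg_self_of_odd (hn : n = 2 * N + 1) {x : ZMod n} (hx : x ≠ 0) : x ≠ -x := fun h =>
  two_mul_ne_zero_of_odd hn hx (by linear_combination h)

theorem exists_two_mul_eq (hn : n = 2 * N + 1) (x : ZMod n) : ∃ y, 2 * y = x := by
  have hN : (2 * N + 1 : ZMod n) = 0 := by
    have := ZMod.natCast_self n
    rw [hn] at this ⊢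
    exact_mod_cast this
  exact ⟨-(N : ZMod n) * x, by linear_combination (-x) * hN⟩

variable {Z : Type*} [AddCommGroup Z]

/-- The odd extension to `ℤ/n` of a function given on `1, …, (n - 1) / 2`. -/
def oddExt (N : ℕ) (h : ℕ → Z) (x : ZMod n) : Z :=
  if x = 0 then 0 else if x.val ≤ N then h x.val else -h (-x).val

/-- `0` on the residues `1, …, (n - 1) / 2`, and `2` on their negatives. -/
def halfSign (N : ℕ) (x : ZMod n) : ZMod 4 := if x.val ≤ N then 0 else 2

theorem val_natCast_half (hn : n = 2 * N + 1) {u : ℕ} (h2 : u ≤ N) : (u : ZMod n).val = u :=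
  ZMod.val_natCast_of_lt (by omega)

theorem val_neg_natCast_half (hn : n = 2 * N + 1) {u : ℕ} (h1 : 1 ≤ u) (h2 : u ≤ N) :
    (-(u : ZMod n)).val = n - u := by
  have : NeZero n := ⟨by omega⟩
  have : NeZero (u : ZMod n) := ⟨natCast_ne_zero_of_le hn h1 h2⟩
  rw [ZMod.val_neg_of_ne_zero, val_natCast_half hn h2]

theorem oddExt_natCast (hn : n = 2 * N + 1) (h : ℕ → Z) {u : ℕ} (h1 : 1 ≤ u) (h2 : u ≤ N) :
    oddExt N h (u : ZMod n) = h u := by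
  rw [oddExt, if_neg (natCast_ne_zero_of_le hn h1 h2), val_natCast_half hn h2, if_pos h2]

theorem oddExt_neg_natCast (hn : n = 2 * N + 1) (h : ℕ → Z) {u : ℕ} (h1 : 1 ≤ u) (h2 : u ≤ N) :
    oddExt N h (-(u : ZMod n)) = -h u := by
  rw [oddExt, if_neg (neg_ne_zero.2 (natCast_ne_zero_of_le hn h1 h2)),
    val_neg_natCast_half hn h1 h2, if_neg (by omega), neg_neg, val_natCast_half hn h2]

theorem halfSign_natCast (hn : n = 2 * N + 1) {u : ℕ} (h2 : u ≤ N) :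
    halfSign N (u : ZMod n) = 0 := by
  rw [halfSign, val_natCast_half hn h2, if_pos h2]

theorem halfSign_neg_natCast (hn : n = 2 * N + 1) {u : ℕ} (h1 : 1 ≤ u) (h2 : u ≤ N) :
    halfSign N (-(u : ZMod n)) = 2 := by
  rw [halfSign, val_neg_natCast_half hn h1 h2, if_neg (by omega)]

theorem oddExt_neg (hn : n = 2 * N + 1) (h : ℕ → Z) (x : ZMod n) :
    oddExt N h (-x) = -oddExt N h x := by
  rcases exists_half_repr hn x with rfl | ⟨u, h1, h2, rfl | rfl⟩
  · simp [oddExt]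
  · rw [oddExt_natCast hn h h1 h2, oddExt_neg_natCast hn h h1 h2]
  · rw [neg_neg, oddExt_natCast hn h h1 h2, oddExt_neg_natCast hn h h1 h2, neg_neg]

theorem map_oddExt (hn : n = 2 * N + 1) (h : ℕ → Z) (r : Z →+ ZMod n)
    (hr : ∀ u, 1 ≤ u → u ≤ N → r (h u) = u) (x : ZMod n) : r (oddExt N h x) = x := by
  rcases exists_half_repr hn x with rfl | ⟨u, h1, h2, rfl | rfl⟩
  · simp [oddExt]
  · rw [oddExt_natCast hn h h1 h2, hr u h1 h2]
  · rw [oddExt_neg_natCast hn h h1 h2, map_neg, hr u h1 h2]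

theorem halfSign_add_neg (hn : n = 2 * N + 1) {x : ZMod n} (hx : x ≠ 0) :
    halfSign N x + halfSign N (-x) = 2 := by
  rcases exists_half_repr hn x with rfl | ⟨u, h1, h2, rfl | rfl⟩
  · exact absurd rfl hx
  · rw [halfSign_natCast hn h2, halfSign_neg_natCast hn h1 h2, zero_add]
  · rw [neg_neg, halfSign_natCast hn h2, halfSign_neg_natCast hn h1 h2, add_zero]

end HalfSystem

/-! ### Base factors given by steps on a quotient group. -/

section Blocks

variable {Z : Type*} [AddCommGroup Z] {n N : ℕ}

/-- Reduction modulo `2` on the first component, and `r` on the second one. -/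
def reduction {Q : Type*} [AddCommGroup Q] (r : Z →+ Q) : ZMod 4 × Z →+ ZMod 2 × Q :=
  (ZMod.castHom (by norm_num : 2 ∣ 4) (ZMod 2)).toAddMonoidHom.prodMap r

/-- A map `δ` on the quotient `Q` of `G` such that `x ↦ x + δ (π x)` has all its cycles of length
`4`, with steps outside the subgroup of elements with second component zero. -/
structure IsBlock {Q : Type*} [AddCommGroup Q] (π : ZMod 4 × Z →+ Q) (δ : Q → ZMod 4 × Z) :
    Prop where
  step_ne : ∀ q, (δ q).2 ≠ 0
  closed : ∀ q, δ q + δ (π (δ q) + q) + δ (π (δ (π (δ q) + q)) + (π (δ q) + q)) +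
    δ (π (δ (π (δ (π (δ q) + q)) + (π (δ q) + q))) + (π (δ (π (δ q) + q)) + (π (δ q) + q))) = 0
  two_step_ne : ∀ q, δ q + δ (π (δ q) + q) ≠ 0

/-- Naming the four residues visited replaces the nested expressions of `IsBlock` by conditions on
explicit steps. Two steps are seen not to cancel already in the `ℤ/4` component. -/
theorem IsBlock.of_orbit {Q : Type*} [AddCommGroup Q] {π : ZMod 4 × Z →+ Q} {δ : Q → ZMod 4 × Z}
    (h : ∀ q₀, ∃ q₁ q₂ q₃ d₀ d₁ d₂ d₃, δ q₀ = d₀ ∧ δ q₁ = d₁ ∧ δ q₂ = d₂ ∧ δ q₃ = d₃ ∧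
      π d₀ + q₀ = q₁ ∧ π d₁ + q₁ = q₂ ∧ π d₂ + q₂ = q₃ ∧
      d₀.2 ≠ 0 ∧ d₀ + d₁ + d₂ + d₃ = 0 ∧ d₀.1 + d₁.1 ≠ 0) : IsBlock π δ where
  step_ne q := by
    obtain ⟨_, _, _, _, _, _, _, rfl, -, -, -, -, -, -, h, -, -⟩ := h q
    exact h
  closed q := by
    obtain ⟨_, _, _, _, _, _, _, rfl, rfl, rfl, rfl, rfl, rfl, rfl, -, h, -⟩ := h q
    exact h
  two_step_ne q := by
    obtain ⟨_, _, _, _, _, _, _, rfl, rfl, rfl, rfl, rfl, rfl, rfl, -, -, h⟩ := h q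
    exact fun h' => h (congrArg Prod.fst h')

/-- The steps of the factor consisting of translates of `(0,0), (1,z), (2,0), (3,z)`. -/
def edgeSteps (z : Z) (q : ZMod 2) : ZMod 4 × Z := (1, if q = 0 then z else -z)

/-- The steps of a factor on `ℤ/4 × Z`, as a function on `ℤ/2 × ℤ/n`: an orbit of cycles
`(0,0), (1,e), (2,0), (3,e)`, orbits of cycles `(0,w), (0,-w), (2,w), (2,-w)` and of cycles
`(1,e+w), (1,e-w), (3,e+w), (3,e-w)` and, if `par` holds, one orbit of cycles
`(0,-z), (1,e'-z), (1,e'+z), (2,z)`. -/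
def pairSteps (N : ℕ) (r : Z →+ ZMod n) (h₀ h₁ : ℕ → Z) (e : Z) (par : Prop) [Decidable par]
    (z e' : Z) (q : ZMod 2 × ZMod n) : ZMod 4 × Z :=
  if q.1 = 0 then
    if q.2 = 0 then (1, e)
    else if par ∧ q.2 = -r z then (1, e')
    else if par ∧ q.2 = r z then (2, -(2 • z))
    else (halfSign N q.2, -(2 • oddExt N h₀ q.2))
  else
    if q.2 - r e = 0 then (1, -e)
    else if par ∧ q.2 - r e = -r z then (0, 2 • z)
    else if par ∧ q.2 - r e = r z then (1, -e')
    else (halfSign N (q.2 - r e), -(2 • oddExt N h₁ (q.2 - r e)))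

end Blocks

/-! ### The base factors consist of 4-cycles. -/

section BlockProofs

variable {Z : Type*} [AddCommGroup Z] {n N : ℕ}

/-- Reduction of the first component modulo `2`. -/
def parity (Z : Type*) [AddCommGroup Z] : ZMod 4 × Z →+ ZMod 2 :=
  (ZMod.castHom (by norm_num : 2 ∣ 4) (ZMod 2)).toAddMonoidHom.comp (AddMonoidHom.fst _ _)

theorem parity_apply (i : ZMod 4) (z : Z) :
    parity Z (i, z) = ZMod.castHom (by norm_num : 2 ∣ 4) (ZMod 2) i := rfl

theorem isBlock_edgeSteps {z : Z} (hz : z ≠ 0) : IsBlock (parity Z) (edgeSteps z) := by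
  have c1 : ZMod.castHom (by norm_num : 2 ∣ 4) (ZMod 2) 1 = 1 := map_one _
  refine .of_orbit fun q => ⟨1 + q, q, 1 + q, _, _, _, _, rfl, rfl, rfl, rfl, ?_⟩
  simp only [edgeSteps, parity_apply, c1, true_and]
  have h2 : (1 + 1 : ZMod 2) = 0 := by decide
  refine ⟨by rw [← add_assoc, h2, zero_add], ?_, ?_, by decide⟩
  · split_ifs <;> simpa
  · have h01 : q = 0 ∨ q = 1 := by revert q; decide
    rcases h01 with rfl | rfl <;>
      simp [Prod.ext_iff, h2] <;> decide

variable {r : Z →+ ZMod n} {h₀ h₁ : ℕ → Z} {e z e' : Z} {par : Prop} [Decidable par]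

theorem pairSteps_zero_zero : pairSteps N r h₀ h₁ e par z e' (0, 0) = (1, e) := by
  simp [pairSteps]

theorem pairSteps_one_center : pairSteps N r h₀ h₁ e par z e' (1, r e) = (1, -e) := by
  simp [pairSteps]

theorem pairSteps_zero {y : ZMod n} (hy : y ≠ 0) (h1 : par → y ≠ r z) (h2 : par → y ≠ -r z) :
    pairSteps N r h₀ h₁ e par z e' (0, y) = (halfSign N y, -(2 • oddExt N h₀ y)) := by
  have h1' : ¬ (par ∧ y = r z) := fun h => h1 h.1 h.2
  have h2' : ¬ (par ∧ y = -r z) := fun h => h2 h.1 h.2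
  simp only [pairSteps, if_true, if_neg hy, if_neg h1', if_neg h2']

theorem pairSteps_one {y : ZMod n} (hy : y ≠ 0) (h1 : par → y ≠ r z) (h2 : par → y ≠ -r z) :
    pairSteps N r h₀ h₁ e par z e' (1, y + r e) = (halfSign N y, -(2 • oddExt N h₁ y)) := by
  have h1' : ¬ (par ∧ y = r z) := fun h => h1 h.1 h.2
  have h2' : ¬ (par ∧ y = -r z) := fun h => h2 h.1 h.2
  simp only [pairSteps, one_ne_zero, if_false, add_sub_cancel_right, if_neg hy, if_neg h1',
    if_neg h2']

theorem pairSteps_par₀ (hp : par) (hz : r z ≠ 0) :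
    pairSteps N r h₀ h₁ e par z e' (0, -r z) = (1, e') := by
  simp [pairSteps, hp, hz]

theorem pairSteps_par₁ (hp : par) (hz : r z ≠ 0) :
    pairSteps N r h₀ h₁ e par z e' (1, -r z + r e) = (0, 2 • z) := by
  simp [pairSteps, hp, hz]

theorem pairSteps_par₂ (hn : n = 2 * N + 1) (hp : par) (hz : r z ≠ 0) :
    pairSteps N r h₀ h₁ e par z e' (1, r z + r e) = (1, -e') := by
  simp [pairSteps, hp, hz, ne_neg_self_of_odd hn hz]

theorem pairSteps_par₃ (hn : n = 2 * N + 1) (hp : par) (hz : r z ≠ 0) :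
    pairSteps N r h₀ h₁ e par z e' (0, r z) = (2, -(2 • z)) := by
  simp [pairSteps, hp, hz, ne_neg_self_of_odd hn hz]

/-- Since `h₀` and `h₁` lift residues along `r`, a generic step reflects the residue, in `0` on the
even level and in `r e` on the odd one. Two such steps have opposite second components and add `2`
in `ℤ/4`, so four close up. The condition `r e' = r e` lets the exceptional cycle enter the odd
level at residues symmetric about the same centre. -/
theorem isBlock_pairSteps (hn : n = 2 * N + 1) (hr₀ : ∀ u, 1 ≤ u → u ≤ N → r (h₀ u) = u)
    (hr₁ : ∀ u, 1 ≤ u → u ≤ N → r (h₁ u) = u) (he : e ≠ 0)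
    (hpar : par → r z ≠ 0 ∧ e' ≠ 0 ∧ r e' = r e) :
    IsBlock (reduction r) (pairSteps N r h₀ h₁ e par z e') := by
  have c0 : ZMod.castHom (by norm_num : 2 ∣ 4) (ZMod 2) 0 = 0 := map_zero _
  have c1 : ZMod.castHom (by norm_num : 2 ∣ 4) (ZMod 2) 1 = 1 := map_one _
  have c2 : ZMod.castHom (by norm_num : 2 ∣ 4) (ZMod 2) 2 = 0 := by decide
  have cs : ∀ y : ZMod n, ZMod.castHom (by norm_num : 2 ∣ 4) (ZMod 2) (halfSign N y) = 0 := by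
    intro y
    unfold halfSign
    split_ifs <;> assumption
  have e2 : (1 + 1 : ZMod 2) = 0 := by decide
  have e4 : (2 + 2 : ZMod 4) = 0 := by decide
  have two_smul_ne : ∀ w : Z, r w ≠ 0 → 2 • w ≠ 0 := fun w hw h => by
    have := congrArg r h
    rw [map_nsmul, map_zero, nsmul_eq_mul] at this
    exact two_mul_ne_zero_of_odd hn hw (by exact_mod_cast this)
  have ext_ne : ∀ h : ℕ → Z, (∀ u, 1 ≤ u → u ≤ N → r (h u) = u) → ∀ y : ZMod n, y ≠ 0 →
      -(2 • oddExt N h y) ≠ 0 := fun h hr y hy =>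
    neg_ne_zero.2 (two_smul_ne _ (by rwa [map_oddExt hn h r hr]))
  refine .of_orbit ?_
  have level : ∀ l : ZMod 2, l = 0 ∨ l = 1 := by decide
  have pe : ∀ (i : ZMod 4) (w : Z) (l : ZMod 2) (x : ZMod n), reduction r (i, w) + (l, x) =
      (ZMod.castHom (by norm_num : 2 ∣ 4) (ZMod 2) i + l, r w + x) := fun _ _ _ _ => rfl
  rintro ⟨l, x⟩
  rcases level l with rfl | rfl
  · by_cases hx : x = 0
    · subst hx
      refine ⟨_, _, _, _, _, _, _, pairSteps_zero_zero, pairSteps_one_center,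
        pairSteps_zero_zero, pairSteps_one_center, ?_, ?_, ?_, he, Prod.ext ?_ ?_, ?_⟩
      · simp [pe, c1]
      · simp [pe, c1, e2]
      · simp [pe, c1]
      · simp; decide
      · simp
      · simp; decide
    -- The exceptional cycle meets four residue classes; each gives a case, with the same cycle
    -- started at another vertex.
    by_cases hp : par ∧ x = -r z
    · obtain ⟨hp, rfl⟩ := hp
      obtain ⟨hz, he', hee⟩ := hpar hp
      refine ⟨_, _, _, _, _, _, _, pairSteps_par₀ hp hz, pairSteps_par₁ hp hz,
        pairSteps_par₂ hn hp hz, pairSteps_par₃ hn hp hz, ?_, ?_, ?_, he', Prod.ext ?_ ?_, ?_⟩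
      · simp [pe, c1, hee, add_comm]
      · simp only [pe, c0, map_nsmul, zero_add, Prod.mk.injEq, true_and]; abel
      · simp [pe, c1, e2, hee]
      · simp; decide
      · simp
      · simp; decide
    by_cases hp' : par ∧ x = r z
    · obtain ⟨hq, rfl⟩ := hp'
      obtain ⟨hz, he', hee⟩ := hpar hq
      refine ⟨_, _, _, _, _, _, _, pairSteps_par₃ hn hq hz, pairSteps_par₀ hq hz,
        pairSteps_par₁ hq hz, pairSteps_par₂ hn hq hz, ?_, ?_, ?_,
        neg_ne_zero.2 (two_smul_ne z hz), Prod.ext ?_ ?_, ?_⟩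
      · simp only [pe, c2, map_nsmul, map_neg, zero_add, Prod.mk.injEq, true_and]; abel
      · simp [pe, c1, hee, add_comm]
      · simp only [pe, c0, map_nsmul, zero_add, Prod.mk.injEq, true_and]; abel
      · simp; decide
      · simp
      · simp; decide
    · have k1 : par → x ≠ r z := fun h h' => hp' ⟨h, h'⟩
      have k2 : par → x ≠ -r z := fun h h' => hp ⟨h, h'⟩
      have hx' : -x ≠ 0 := neg_ne_zero.2 hx
      have k3 : par → -x ≠ r z := fun h h' => k2 h (by rw [← h', neg_neg])
      have k4 : par → -x ≠ -r z := fun h h' => k1 h (neg_injective h')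
      have hs := halfSign_add_neg hn hx
      have m1 : r (-(2 • oddExt N h₀ x)) + x = -x := by
        rw [map_neg, map_nsmul, map_oddExt hn h₀ r hr₀]; abel
      have m2 : r (-(2 • oddExt N h₀ (-x))) + -x = x := by
        rw [map_neg, map_nsmul, map_oddExt hn h₀ r hr₀]; abel
      refine ⟨_, _, _, _, _, _, _, pairSteps_zero hx k1 k2, pairSteps_zero hx' k3 k4,
        pairSteps_zero hx k1 k2, pairSteps_zero hx' k3 k4, ?_, ?_, ?_, ext_ne h₀ hr₀ x hx,
        Prod.ext ?_ ?_, ?_⟩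
      · rw [pe, cs, m1, zero_add]
      · rw [pe, cs, m2, zero_add]
      · rw [pe, cs, m1, zero_add]
      · simp only [Prod.fst_add, Prod.fst_zero]
        linear_combination 2 * hs + e4
      · simp [oddExt_neg hn]
      · simp only [hs]; decide
  · obtain ⟨y, rfl⟩ : ∃ y, x = y + r e := ⟨x - r e, by abel⟩
    by_cases hx : y = 0
    · subst hx
      rw [zero_add]
      refine ⟨_, _, _, _, _, _, _, pairSteps_one_center, pairSteps_zero_zero,
        pairSteps_one_center, pairSteps_zero_zero, ?_, ?_, ?_, neg_ne_zero.2 he,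
        Prod.ext ?_ ?_, ?_⟩
      · simp [pe, c1, e2]
      · simp [pe, c1]
      · simp [pe, c1, e2]
      · simp; decide
      · simp
      · simp; decide
    by_cases hp : par ∧ y = -r z
    · obtain ⟨hp, rfl⟩ := hp
      obtain ⟨hz, he', hee⟩ := hpar hp
      refine ⟨_, _, _, _, _, _, _, pairSteps_par₁ hp hz,
        pairSteps_par₂ hn hp hz, pairSteps_par₃ hn hp hz, pairSteps_par₀ hp hz, ?_, ?_, ?_,
        two_smul_ne z hz, Prod.ext ?_ ?_, ?_⟩
      · simp only [pe, c0, map_nsmul, zero_add, Prod.mk.injEq, true_and]; abel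
      · simp [pe, c1, e2, hee]
      · simp only [pe, c2, map_nsmul, map_neg, zero_add, Prod.mk.injEq, true_and]; abel
      · simp; decide
      · simp
      · simp; decide
    by_cases hp' : par ∧ y = r z
    · obtain ⟨hq, rfl⟩ := hp'
      obtain ⟨hz, he', hee⟩ := hpar hq
      refine ⟨_, _, _, _, _, _, _, pairSteps_par₂ hn hq hz, pairSteps_par₃ hn hq hz,
        pairSteps_par₀ hq hz, pairSteps_par₁ hq hz, ?_, ?_, ?_,
        neg_ne_zero.2 he', Prod.ext ?_ ?_, ?_⟩
      · simp [pe, c1, e2, hee]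
      · simp only [pe, c2, map_nsmul, map_neg, zero_add, Prod.mk.injEq, true_and]; abel
      · simp [pe, c1, hee, add_comm]
      · simp; decide
      · simp
      · simp; decide
    · have k1 : par → y ≠ r z := fun h h' => hp' ⟨h, h'⟩
      have k2 : par → y ≠ -r z := fun h h' => hp ⟨h, h'⟩
      have hx' : -y ≠ 0 := neg_ne_zero.2 hx
      have k3 : par → -y ≠ r z := fun h h' => k2 h (by rw [← h', neg_neg])
      have k4 : par → -y ≠ -r z := fun h h' => k1 h (neg_injective h')
      have hs := halfSign_add_neg hn hx
      have m1 : r (-(2 • oddExt N h₁ y)) + (y + r e) = -y + r e := by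
        rw [map_neg, map_nsmul, map_oddExt hn h₁ r hr₁]; abel
      have m2 : r (-(2 • oddExt N h₁ (-y))) + (-y + r e) = y + r e := by
        rw [map_neg, map_nsmul, map_oddExt hn h₁ r hr₁]; abel
      refine ⟨_, _, _, _, _, _, _, pairSteps_one hx k1 k2, pairSteps_one hx' k3 k4,
        pairSteps_one hx k1 k2, pairSteps_one hx' k3 k4, ?_, ?_, ?_, ext_ne h₁ hr₁ y hx,
        Prod.ext ?_ ?_, ?_⟩
      · rw [pe, cs, m1, zero_add]
      · rw [pe, cs, m2, zero_add]
      · rw [pe, cs, m1, zero_add]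
      · simp only [Prod.fst_add, Prod.fst_zero]
        linear_combination 2 * hs + e4
      · simp [oddExt_neg hn]
      · simp only [hs]; decide

end BlockProofs

/-! ### The list of base factors and the differences they cover. -/

section Construction

variable {Z : Type*} [AddCommGroup Z]

/-- The differences `(0, 2w)` and `(2, 2w)` lie in `D`, up to sign. -/
def CoversPure (D : Set (ZMod 4 × Z)) (w : Z) : Prop :=
  ((0, 2 • w) ∈ D ∨ (0, -(2 • w)) ∈ D) ∧ ((2, 2 • w) ∈ D ∨ (2, -(2 • w)) ∈ D)

/-- The differences `(1, w)` and `(1, -w)` lie in `D`. -/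
def CoversMixed (D : Set (ZMod 4 × Z)) (w : Z) : Prop := (1, w) ∈ D ∧ (1, -w) ∈ D

theorem CoversPure.mono {D D' : Set (ZMod 4 × Z)} (h : D ⊆ D') {w : Z} (hw : CoversPure D w) :
    CoversPure D' w :=
  ⟨hw.1.imp (@h _) (@h _), hw.2.imp (@h _) (@h _)⟩

theorem CoversMixed.mono {D D' : Set (ZMod 4 × Z)} (h : D ⊆ D') {w : Z} (hw : CoversMixed D w) :
    CoversMixed D' w :=
  ⟨h hw.1, h hw.2⟩

theorem CoversPure.neg {D : Set (ZMod 4 × Z)} {w : Z} (hw : CoversPure D w) :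
    CoversPure D (-w) := by
  simpa only [CoversPure, smul_neg, neg_neg, or_comm] using hw

theorem CoversMixed.neg {D : Set (ZMod 4 × Z)} {w : Z} (hw : CoversMixed D w) :
    CoversMixed D (-w) := by
  simpa only [CoversMixed, neg_neg, and_comm] using hw

theorem coversMixed_edgeSteps (w : Z) : CoversMixed (Set.range (edgeSteps w)) w :=
  ⟨⟨0, by simp [edgeSteps]⟩, ⟨1, by simp [edgeSteps]⟩⟩

variable {n N : ℕ} {r : Z →+ ZMod n} {h₀ h₁ : ℕ → Z} {e z e' : Z} {par : Prop} [Decidable par]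

theorem coversMixed_pairSteps :
    CoversMixed (Set.range (pairSteps N r h₀ h₁ e par z e')) e :=
  ⟨⟨_, pairSteps_zero_zero⟩, ⟨_, pairSteps_one_center⟩⟩

theorem coversMixed_pairSteps_par (hn : n = 2 * N + 1) (hp : par) (hz : r z ≠ 0) :
    CoversMixed (Set.range (pairSteps N r h₀ h₁ e par z e')) e' :=
  ⟨⟨_, pairSteps_par₀ hp hz⟩, ⟨_, pairSteps_par₂ hn hp hz⟩⟩

theorem coversPure_pairSteps_par (hn : n = 2 * N + 1) (hp : par) (hz : r z ≠ 0) :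
    CoversPure (Set.range (pairSteps N r h₀ h₁ e par z e')) z :=
  ⟨Or.inl ⟨_, pairSteps_par₁ hp hz⟩, Or.inr ⟨_, pairSteps_par₃ hn hp hz⟩⟩

theorem coversPure_pairSteps_zero (hn : n = 2 * N + 1) {u : ℕ} (h1 : 1 ≤ u) (h2 : u ≤ N)
    (hu : par → (u : ZMod n) ≠ r z ∧ (u : ZMod n) ≠ -r z) :
    CoversPure (Set.range (pairSteps N r h₀ h₁ e par z e')) (h₀ u) := by
  have h0 := natCast_ne_zero_of_le hn h1 h2
  refine ⟨Or.inr ⟨_, (pairSteps_zero h0 (fun h => (hu h).1) (fun h => (hu h).2)).trans ?_⟩,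
    Or.inl ⟨_, (pairSteps_zero (neg_ne_zero.2 h0)
      (fun h h' => (hu h).2 (by rw [← h', neg_neg]))
      (fun h h' => (hu h).1 (neg_injective h'))).trans ?_⟩⟩
  · rw [halfSign_natCast hn h2, oddExt_natCast hn _ h1 h2]
  · rw [halfSign_neg_natCast hn h1 h2, oddExt_neg_natCast hn _ h1 h2, smul_neg, neg_neg]

theorem coversPure_pairSteps_one (hn : n = 2 * N + 1) {u : ℕ} (h1 : 1 ≤ u) (h2 : u ≤ N)
    (hu : par → (u : ZMod n) ≠ r z ∧ (u : ZMod n) ≠ -r z) :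
    CoversPure (Set.range (pairSteps N r h₀ h₁ e par z e')) (h₁ u) := by
  have h0 := natCast_ne_zero_of_le hn h1 h2
  refine ⟨Or.inr ⟨_, (pairSteps_one h0 (fun h => (hu h).1) (fun h => (hu h).2)).trans ?_⟩,
    Or.inl ⟨_, (pairSteps_one (neg_ne_zero.2 h0)
      (fun h h' => (hu h).2 (by rw [← h', neg_neg]))
      (fun h h' => (hu h).1 (neg_injective h'))).trans ?_⟩⟩
  · rw [halfSign_natCast hn h2, oddExt_natCast hn _ h1 h2]
  · rw [halfSign_neg_natCast hn h1 h2, oddExt_neg_natCast hn _ h1 h2, smul_neg, neg_neg]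

/-- The elements `w` for which the factor of translates of `(0,0), (1,w), (2,0), (3,w)` is used. -/
def restElement (a b A k : ℕ) :
    (Fin (A - 1) × ZMod b) ⊕ Fin (2 * A) ⊕ Fin k → ZMod a × ZMod b
  | .inl (i, y) => ((i + 2 : ℕ), y)
  | .inr (.inl i) => (1, (k + 1 + i : ℕ))
  | .inr (.inr j) => (0, (j + 1 : ℕ))

/-- The steps of the factor whose stabilizer contains `ℤ/a`. -/
def stepsB (a b A k : ℕ) : ZMod 2 × ZMod b → ZMod 4 × (ZMod a × ZMod b) :=
  pairSteps (A + k) (AddMonoidHom.snd _ _) (fun v => (0, (v : ZMod b)))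
    (fun v => (((max 1 (v - k) : ℕ) : ZMod a), (v : ZMod b))) (1, 0) False 0 0

/-- The steps of the `j`-th factor whose stabilizer contains `ℤ/b`. -/
def stepsA (a b A k j : ℕ) : ZMod 2 × ZMod a → ZMod 4 × (ZMod a × ZMod b) :=
  pairSteps A (AddMonoidHom.fst _ _) (fun u => ((u : ZMod a), (k + u + j : ZMod b)))
    (fun u => ((u : ZMod a), (k + u - j : ZMod b))) (if j ≤ k then 1 else 0, (j : ZMod b))
    (j ≤ k) (1, (k + 1 + j : ZMod b)) (1, -(j : ZMod b))

/-- All differences, indexed by the factors and their vertices modulo the stabilizer. -/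
def allSteps (a b A k : ℕ) : (ZMod 2 × ZMod b) ⊕ (Fin (A + k) × (ZMod 2 × ZMod a)) ⊕
    (((Fin (A - 1) × ZMod b) ⊕ Fin (2 * A) ⊕ Fin k) × ZMod 2) → ZMod 4 × (ZMod a × ZMod b)
  | .inl q => stepsB a b A k q
  | .inr (.inl (j, q)) => stepsA a b A k (j + 1) q
  | .inr (.inr (i, q)) => edgeSteps (restElement a b A k i) q

/-- The translation action on the index set of `allSteps`. -/
def indexAct (a b A k : ℕ) (g : ZMod 4 × (ZMod a × ZMod b)) :
    (ZMod 2 × ZMod b) ⊕ (Fin (A + k) × (ZMod 2 × ZMod a)) ⊕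
    (((Fin (A - 1) × ZMod b) ⊕ Fin (2 * A) ⊕ Fin k) × ZMod 2) →
    (ZMod 2 × ZMod b) ⊕ (Fin (A + k) × (ZMod 2 × ZMod a)) ⊕
    (((Fin (A - 1) × ZMod b) ⊕ Fin (2 * A) ⊕ Fin k) × ZMod 2)
  | .inl q => .inl (reduction (AddMonoidHom.snd _ _) g + q)
  | .inr (.inl (j, q)) => .inr (.inl (j, reduction (AddMonoidHom.fst _ _) g + q))
  | .inr (.inr (i, q)) => .inr (.inr (i, parity _ g + q))

variable {a b A k : ℕ} (ha : a = 2 * A + 1) (hb : b = 2 * (A + k) + 1) (hA : 1 ≤ A)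

include ha hb hA

omit hb in
theorem fst_one_ne_zero : (1 : ZMod a) ≠ 0 := by
  simpa using natCast_ne_zero_of_le ha le_rfl hA

theorem isBlock_stepsB : IsBlock (reduction (AddMonoidHom.snd _ _)) (stepsB a b A k) :=
  isBlock_pairSteps hb (fun _ _ _ => rfl) (fun _ _ _ => rfl)
    (fun h => fst_one_ne_zero ha hA (congrArg Prod.fst h)) False.elim

theorem isBlock_stepsA {j : ℕ} (h1 : 1 ≤ j) (h2 : j ≤ A + k) :
    IsBlock (reduction (AddMonoidHom.fst _ _)) (stepsA a b A k j) :=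
  isBlock_pairSteps ha (fun _ _ _ => rfl) (fun _ _ _ => rfl)
    (fun h => natCast_ne_zero_of_le hb h1 h2 (congrArg Prod.snd h))
    fun h => ⟨fst_one_ne_zero ha hA, fun h => fst_one_ne_zero ha hA (congrArg Prod.fst h),
      by simp [h]⟩

theorem restElement_ne_zero (i) : restElement a b A k i ≠ 0 := by
  rcases i with ⟨i, y⟩ | i | j
  · exact fun h => natCast_ne_zero_of_le ha (by omega) (by omega) (congrArg Prod.fst h)
  · exact fun h => fst_one_ne_zero ha hA (congrArg Prod.fst h)
  · exact fun h => natCast_ne_zero_of_le hb (by omega) (by omega) (congrArg Prod.snd h)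

omit ha hb hA in
theorem stepsB_subset : Set.range (stepsB a b A k) ⊆ Set.range (allSteps a b A k) := by
  rintro _ ⟨q, rfl⟩
  exact ⟨.inl q, rfl⟩

omit ha hb hA in
theorem stepsA_subset {j : ℕ} (h1 : 1 ≤ j) (h2 : j ≤ A + k) :
    Set.range (stepsA a b A k j) ⊆ Set.range (allSteps a b A k) := by
  rintro _ ⟨q, rfl⟩
  exact ⟨.inr (.inl (⟨j - 1, by omega⟩, q)), by simp [allSteps, Nat.sub_add_cancel h1]⟩

omit ha hb hA in
theorem coversMixed_restElement (i) :
    CoversMixed (Set.range (allSteps a b A k)) (restElement a b A k i) := by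
  refine (coversMixed_edgeSteps _).mono ?_
  rintro _ ⟨q, rfl⟩
  exact ⟨.inr (.inr (i, q)), rfl⟩

/-- The second component is measured from `k + u`. Offset `0` comes from `stepsB`, and offsets `j`
and `-j` from the two levels of `stepsA j`. For `u = 1` and `j ≤ k` the exceptional cycle of `stepsA
j` keeps only the offset `j`, and `stepsB` supplies `-j`. -/
theorem coversPure_allSteps_of_half {u : ℕ} (h1 : 1 ≤ u) (h2 : u ≤ A) (y : ZMod b) :
    CoversPure (Set.range (allSteps a b A k)) ((u : ZMod a), y) := by
  have hone : ∀ {u : ℕ}, 1 ≤ u → u ≤ A → u ≠ 1 → (u : ZMod a) ≠ 1 ∧ (u : ZMod a) ≠ -1 := by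
    intro u h1 h2 h
    constructor <;> intro h'
    · have : ((u - 1 : ℕ) : ZMod a) = 0 := by rw [Nat.cast_sub h1, h']; simp
      exact natCast_ne_zero_of_le ha (by omega) (by omega) this
    · have : ((u + 1 : ℕ) : ZMod a) = 0 := by rw [Nat.cast_add, h']; simp
      rw [ZMod.natCast_eq_zero_iff] at this
      have := Nat.le_of_dvd (by omega) this
      omega
  have hB : ∀ v : ℕ, 1 ≤ v → v ≤ A + k → CoversPure (Set.range (allSteps a b A k))
      (((max 1 (v - k) : ℕ) : ZMod a), (v : ZMod b)) := fun v hv hv' =>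
    (coversPure_pairSteps_one hb hv hv' False.elim).mono stepsB_subset
  obtain ⟨t, rfl⟩ : ∃ t, y = (k + u : ZMod b) + t := ⟨y - (k + u), by abel⟩
  rcases exists_half_repr hb t with rfl | ⟨j, hj, hj', rfl | rfl⟩
  · have := hB (k + u) (by omega) (by omega)
    rw [show max 1 (k + u - k) = u by omega] at this
    simpa using this
  · by_cases hp : j ≤ k ∧ u = 1
    · obtain ⟨hp, rfl⟩ := hp
      refine CoversPure.mono (stepsA_subset hj hj') ?_
      have := coversPure_pairSteps_par (h₀ := fun u => ((u : ZMod a), (k + u + j : ZMod b)))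
        (h₁ := fun u => ((u : ZMod a), (k + u - j : ZMod b)))
        (e := (if j ≤ k then 1 else 0, (j : ZMod b)))
        (z := ((1 : ZMod a), (k + 1 + j : ZMod b))) (e' := (1, -(j : ZMod b)))
        (r := AddMonoidHom.fst _ _) ha hp (fst_one_ne_zero ha hA)
      rw [Nat.cast_one, Nat.cast_one]
      exact this
    · refine CoversPure.mono (stepsA_subset hj hj') ?_
      exact coversPure_pairSteps_zero (h₀ := fun u => ((u : ZMod a), (k + u + j : ZMod b))) ha h1 h2
        fun h => hone h1 h2 fun h' => hp ⟨h, h'⟩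
  · by_cases hp : j ≤ k ∧ u = 1
    · obtain ⟨hp, rfl⟩ := hp
      -- For `v = k + 1 - j ≤ k` the maximum in `stepsB` is `1`, which gives the element that
      -- `stepsA j` omits.
      have := hB (k + 1 - j) (by omega) (by omega)
      rw [show max 1 (k + 1 - j - k) = 1 by omega, Nat.cast_sub (by omega)] at this
      simpa [sub_eq_add_neg] using this
    · refine CoversPure.mono (stepsA_subset hj hj') ?_
      rw [← sub_eq_add_neg]
      exact coversPure_pairSteps_one (h₁ := fun u => ((u : ZMod a), (k + u - j : ZMod b))) ha h1 h2
        fun h => hone h1 h2 fun h' => hp ⟨h, h'⟩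

theorem coversPure_allSteps {w : ZMod a × ZMod b} (hw : w ≠ 0) :
    CoversPure (Set.range (allSteps a b A k)) w := by
  obtain ⟨x, y⟩ := w
  rcases exists_half_repr ha x with rfl | ⟨u, h1, h2, rfl | rfl⟩
  · have key : ∀ v : ℕ, 1 ≤ v → v ≤ A + k →
        CoversPure (Set.range (allSteps a b A k)) (0, (v : ZMod b)) := fun v h1 h2 =>
      (coversPure_pairSteps_zero hb h1 h2 False.elim).mono stepsB_subset
    rcases exists_half_repr hb y with rfl | ⟨v, h1, h2, rfl | rfl⟩
    · exact absurd rfl hw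
    · exact key v h1 h2
    · simpa using (key v h1 h2).neg
  · exact coversPure_allSteps_of_half ha hb hA h1 h2 y
  · simpa using (coversPure_allSteps_of_half ha hb hA h1 h2 (-y)).neg

/-- For `u = 1`, the value `y = 0` comes from `stepsB`, and `y = ± j` with `j ≤ k` from `e` and `e'`
in `stepsA j`. The `2A` values strictly between `k` and `b - k`, and all pairs with `u ≥ 2`, come
from `restElement`. -/
theorem coversMixed_allSteps_of_half {u : ℕ} (h1 : 1 ≤ u) (h2 : u ≤ A) (y : ZMod b) :
    CoversMixed (Set.range (allSteps a b A k)) ((u : ZMod a), y) := by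
  by_cases hu : u = 1
  · subst hu
    rw [Nat.cast_one]
    have hrest : ∀ v : ℕ, k < v → v < b - k →
        CoversMixed (Set.range (allSteps a b A k)) ((1 : ZMod a), (v : ZMod b)) := by
      intro v hv hv'
      have := coversMixed_restElement (a := a) (b := b) (A := A) (k := k)
        (.inr (.inl ⟨v - k - 1, by omega⟩))
      simpa only [restElement, show k + 1 + (v - k - 1) = v by omega] using this
    rcases exists_half_repr hb y with rfl | ⟨j, hj, hj', rfl | rfl⟩
    · exact coversMixed_pairSteps.mono stepsB_subset
    · by_cases hp : j ≤ k
      · have := (coversMixed_pairSteps (N := A) (r := AddMonoidHom.fst _ _)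
          (h₀ := fun u => ((u : ZMod a), (k + u + j : ZMod b)))
          (h₁ := fun u => ((u : ZMod a), (k + u - j : ZMod b)))
          (e := (if j ≤ k then (1 : ZMod a) else 0, (j : ZMod b))) (par := j ≤ k)
          (z := ((1 : ZMod a), (k + 1 + j : ZMod b))) (e' := (1, -(j : ZMod b)))).mono
          (stepsA_subset hj hj')
        simpa only [if_pos hp] using this
      · exact hrest j (by omega) (by omega)
    · by_cases hp : j ≤ k
      · exact (coversMixed_pairSteps_par ha hp (fst_one_ne_zero ha hA)).mono
          (stepsA_subset hj hj')
      · have := hrest (b - j) (by omega) (by omega)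
        rw [Nat.cast_sub (by omega)] at this
        simpa using this
  · have := coversMixed_restElement (a := a) (b := b) (A := A) (k := k)
      (.inl (⟨u - 2, by omega⟩, y))
    simpa only [restElement, show u - 2 + 2 = u by omega] using this

theorem coversMixed_allSteps {w : ZMod a × ZMod b} (hw : w ≠ 0) :
    CoversMixed (Set.range (allSteps a b A k)) w := by
  obtain ⟨x, y⟩ := w
  rcases exists_half_repr ha x with rfl | ⟨u, h1, h2, rfl | rfl⟩
  · have key : ∀ j : ℕ, 1 ≤ j → j ≤ A + k →
        CoversMixed (Set.range (allSteps a b A k)) (0, (j : ZMod b)) := by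
      intro j hj hj'
      by_cases hp : j ≤ k
      · have := coversMixed_restElement (a := a) (b := b) (A := A) (k := k)
          (.inr (.inr ⟨j - 1, by omega⟩))
        simpa only [restElement, Nat.sub_add_cancel hj] using this
      · have := (coversMixed_pairSteps (N := A) (r := AddMonoidHom.fst _ _)
          (h₀ := fun u => ((u : ZMod a), (k + u + j : ZMod b)))
          (h₁ := fun u => ((u : ZMod a), (k + u - j : ZMod b)))
          (e := (if j ≤ k then (1 : ZMod a) else 0, (j : ZMod b))) (par := j ≤ k)
          (z := ((1 : ZMod a), (k + 1 + j : ZMod b))) (e' := (1, -(j : ZMod b)))).mono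
          (stepsA_subset hj hj')
        simpa only [if_neg hp] using this
    rcases exists_half_repr hb y with rfl | ⟨v, h1, h2, rfl | rfl⟩
    · exact absurd rfl hw
    · exact key v h1 h2
    · simpa using (key v h1 h2).neg
  · exact coversMixed_allSteps_of_half ha hb hA h1 h2 y
  · simpa using (coversMixed_allSteps_of_half ha hb hA h1 h2 (-y)).neg

theorem exists_allSteps_eq {d : ZMod 4 × (ZMod a × ZMod b)} (hd : d.2 ≠ 0) :
    ∃ t, allSteps a b A k t = d ∨ allSteps a b A k t = -d := by
  obtain ⟨i, x, y⟩ := d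
  have hi : i = 0 ∨ i = 2 ∨ i = 1 ∨ i = -1 := by clear hd; revert i; decide
  have hsame : ∀ d, d ∈ Set.range (allSteps a b A k) →
      ∃ t, allSteps a b A k t = d ∨ allSteps a b A k t = -d := by
    rintro _ ⟨t, rfl⟩
    exact ⟨t, Or.inl rfl⟩
  have hneg : ∀ d, -d ∈ Set.range (allSteps a b A k) →
      ∃ t, allSteps a b A k t = d ∨ allSteps a b A k t = -d := by
    rintro d ⟨t, ht⟩
    exact ⟨t, Or.inr ht⟩
  -- `CoversPure` is about doubled elements, so the second component is halved, which is possible in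
  -- odd order.
  obtain ⟨x', rfl⟩ := exists_two_mul_eq ha x
  obtain ⟨y', rfl⟩ := exists_two_mul_eq hb y
  have h2 : ((2 * x', 2 * y') : ZMod a × ZMod b) = 2 • (x', y') := by
    simp
  rw [h2] at hd ⊢
  have hw : ((x', y') : ZMod a × ZMod b) ≠ 0 := fun h => hd (by simp [h])
  have hp := coversPure_allSteps ha hb hA hw (k := k)
  have hm := coversMixed_allSteps ha hb hA hd (k := k)
  have n2 : -(2 : ZMod 4) = 2 := by decide
  rcases hi with rfl | rfl | rfl | rfl
  · exact hp.1.elim (hsame _) fun h => hneg _ (by rwa [Prod.neg_mk, neg_zero])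
  · exact hp.2.elim (hsame _) fun h => hneg _ (by rwa [Prod.neg_mk, n2])
  · exact hsame _ hm.1
  · exact hneg _ (by rw [Prod.neg_mk, neg_neg]; exact hm.2)

end Construction

/-! ### Transport to the cyclic group, and the count of differences. -/

section Existence

/-- The decomposition of `ℤ/4ab` as a direct product. -/
def productEquiv {a b : ℕ} (hab : a.Coprime b) (h4 : (a * b).Coprime 4) :
    ZMod 4 × (ZMod a × ZMod b) ≃+ ZMod (a * b * 4) :=
  ((AddEquiv.prodComm (N := ZMod a × ZMod b)).trans
    ((ZMod.chineseRemainder hab).toAddEquiv.symm.prodCongr (AddEquiv.refl (ZMod 4)))).trans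
    (ZMod.chineseRemainder h4).toAddEquiv.symm

theorem productEquiv_mem_zmultiples {a b : ℕ} (hab : a.Coprime b) (h4 : (a * b).Coprime 4)
    (d : ZMod 4 × (ZMod a × ZMod b)) :
    productEquiv hab h4 d ∈ AddSubgroup.zmultiples ((a * b : ℕ) : ZMod (a * b * 4)) ↔
      d.2 = 0 := by
  have hm : productEquiv hab h4 ((a * b : ℕ), (0, 0)) = ((a * b : ℕ) : ZMod (a * b * 4)) := by
    have h : ∀ k : ℕ, productEquiv hab h4 (k, (k, k)) = k := fun k => by
      have h1 := map_natCast (ZMod.chineseRemainder hab).symm k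
      have h2 := map_natCast (ZMod.chineseRemainder h4).symm k
      exact (congrArg
        (fun x => (ZMod.chineseRemainder h4).symm (x, (k : ZMod 4))) h1).trans h2
    have h0 := h (a * b)
    rwa [show ((a * b : ℕ) : ZMod a) = 0 by simp, show ((a * b : ℕ) : ZMod b) = 0 by simp] at h0
  rw [← hm, AddSubgroup.mem_zmultiples_iff]
  constructor
  · rintro ⟨n, hn⟩
    rw [← map_zsmul, (productEquiv hab h4).injective.eq_iff] at hn
    rw [← hn]
    simp
  · intro hd
    obtain ⟨i, w⟩ := d
    obtain rfl : w = 0 := hd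
    obtain ⟨u, hu⟩ := (ZMod.isUnit_iff_coprime (a * b) 4).2 h4
    -- As `a * b` is a unit modulo 4, the multiples of `(a * b, 0, 0)` fill `ℤ/4 × 0`.
    refine ⟨((↑u⁻¹ * i : ZMod 4).val : ℤ), ?_⟩
    rw [← map_zsmul, ← hu]
    congr 1
    refine Prod.ext ?_ (by simp)
    have : (↑u⁻¹ * i * ↑u : ZMod 4) = i := by rw [mul_right_comm, Units.inv_mul, one_mul]
    simpa using this

theorem card_index_eq {a b A k : ℕ} (ha : a = 2 * A + 1) (hb : b = 2 * (A + k) + 1) (hA : 1 ≤ A)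
    [NeZero a] [NeZero b] :
    2 * Fintype.card ((ZMod 2 × ZMod b) ⊕ (Fin (A + k) × (ZMod 2 × ZMod a)) ⊕
      (((Fin (A - 1) × ZMod b) ⊕ Fin (2 * A) ⊕ Fin k) × ZMod 2)) = 4 * (a * b - 1) := by
  obtain ⟨A, rfl⟩ : ∃ A', A = A' + 1 := ⟨A - 1, by omega⟩
  simp only [Fintype.card_sum, Fintype.card_prod, ZMod.card, Fintype.card_fin]
  subst ha hb
  have : ∀ n, 4 * (n - 1) = 4 * n - 4 := by omega
  rw [this]
  refine Nat.eq_sub_of_add_eq ?_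
  rw [Nat.add_sub_cancel]
  ring

theorem card_snd_ne_zero (Z : Type*) [AddCommGroup Z] [Fintype Z] :
    Nat.card {d : ZMod 4 × Z // d.2 ≠ 0} = 4 * (Fintype.card Z - 1) := by
  classical
  have e : {d : ZMod 4 × Z // d.2 ≠ 0} ≃ ZMod 4 × {z : Z // z ≠ 0} :=
    { toFun := fun d => (d.1.1, ⟨d.1.2, d.2⟩)
      invFun := fun d => ⟨(d.1, d.2.1), d.2.2⟩
      left_inv := fun _ => rfl
      right_inv := fun _ => rfl }
  rw [Nat.card_congr e, Nat.card_eq_fintype_card, Fintype.card_prod, ZMod.card]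
  congr 1
  exact Fintype.card_subtype_compl (fun z : Z => z = 0) |>.trans (by simp)

theorem exists_cyclic_of_coprime {a b A k : ℕ} (ha : a = 2 * A + 1) (hb : b = 2 * (A + k) + 1)
    (hA : 1 ≤ A) (hab : a.Coprime b) :
    ∃ 𝓕 : Set (Set (multipartite (a * b) 4).Subgraph),
      IsCycleFactorization 𝓕 4 ∧ IsCyclicFamily 𝓕 := by
  have : NeZero a := ⟨by omega⟩
  have : NeZero b := ⟨by omega⟩
  have h4 : (a * b).Coprime 4 := by
    have : Odd (a * b) := Odd.mul ⟨A, ha⟩ ⟨A + k, hb⟩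
    exact (Nat.coprime_two_right.2 this).pow_right 2
  have BB := isBlock_stepsB ha hb hA
  have BA := fun j : Fin (A + k) =>
    isBlock_stepsA ha hb hA (j := j + 1) (by omega) (by omega)
  have BR := fun i => isBlock_edgeSteps (restElement_ne_zero ha hb hA i)
  refine exists_cyclic_of_differences (productEquiv hab h4) (indexAct a b A k) ?_ ?_
    (allSteps a b A k) (fun t => indexAct a b A k (allSteps a b A k t) t) (fun _ => rfl)
    ?_ ?_ ?_ ?_ ?_
  · rintro (q | ⟨j, q⟩ | ⟨i, q⟩) <;> simp [indexAct]
  · rintro x y (q | ⟨j, q⟩ | ⟨i, q⟩) <;> simp [indexAct, add_assoc]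
  · simp only [productEquiv_mem_zmultiples]
    rintro (q | ⟨j, q⟩ | ⟨i, q⟩)
    exacts [BB.step_ne q, (BA j).step_ne q, (BR i).step_ne q]
  · rintro (q | ⟨j, q⟩ | ⟨i, q⟩)
    exacts [BB.closed q, (BA j).closed q, (BR i).closed q]
  · rintro (q | ⟨j, q⟩ | ⟨i, q⟩)
    exacts [BB.two_step_ne q, (BA j).two_step_ne q, (BR i).two_step_ne q]
  · intro d hd
    rw [productEquiv_mem_zmultiples] at hd
    exact exists_allSteps_eq ha hb hA hd
  · simp only [productEquiv_mem_zmultiples]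
    refine le_of_eq ((card_index_eq ha hb hA).trans ?_)
    exact ((card_snd_ne_zero _).trans (by simp)).symm

theorem exists_cyclic_of_not_isPrimePow {m : ℕ} (hm : 1 < m) (hodd : Odd m)
    (hpp : ¬ IsPrimePow m) :
    ∃ 𝓕 : Set (Set (multipartite m 4).Subgraph),
      IsCycleFactorization 𝓕 4 ∧ IsCyclicFamily 𝓕 := by
  have key : ∀ a b : ℕ, a.Coprime b → 1 < a → a < b → Odd (a * b) →
      ∃ 𝓕 : Set (Set (multipartite (a * b) 4).Subgraph),
        IsCycleFactorization 𝓕 4 ∧ IsCyclicFamily 𝓕 := by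
    intro a b hab ha hlt hodd
    obtain ⟨⟨A, rfl⟩, ⟨B, rfl⟩⟩ := Nat.odd_mul.1 hodd
    exact exists_cyclic_of_coprime (A := A) (k := B - A) rfl (by omega) (by omega) hab
  obtain ⟨a, b, hab, ha, hb, rfl⟩ : ∃ a b : ℕ, a.Coprime b ∧ 1 < a ∧ 1 < b ∧ a * b = m := by
    -- The full power of a prime `p` is split off; its cofactor exceeds `1` because `m` is not a
    -- prime power.
    obtain ⟨p, hp, hpm⟩ := Nat.exists_prime_and_dvd hm.ne'
    obtain ⟨c, hc⟩ := Nat.ordProj_dvd m p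
    have h1 : 1 < p ^ m.factorization p := Nat.one_lt_pow
      (hp.factorization_pos_of_dvd (by omega) hpm).ne' hp.one_lt
    refine ⟨p ^ m.factorization p, c, ?_, h1, ?_, hc.symm⟩
    · have := Nat.coprime_ordCompl hp (n := m) (by omega)
      have hc' : m / p ^ m.factorization p = c :=
        Nat.div_eq_of_eq_mul_right (by omega) hc
      rw [hc'] at this
      exact this.pow_left _
    · by_contra hc1
      have hc2 : c = 0 ∨ c = 1 := by omega
      rcases hc2 with rfl | rfl
      · omega
      · rw [mul_one] at hc
        exact hpp (hc ▸ hp.isPrimePow.pow (hp.factorization_pos_of_dvd (by omega) hpm).ne')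
  rcases lt_trichotomy a b with h | rfl | h
  · exact key a b hab ha h hodd
  · rw [Nat.coprime_self] at hab
    omega
  · rw [mul_comm a b] at hodd ⊢
    exact key b a hab.symm hb h hodd

end Existence

/-! ### Stabilizers of factors, and nonexistence for prime powers. -/

section Nonexistence

theorem IsCycleOfLength.ncard_verts {V : Type*} {Γ : SimpleGraph V} {C : Γ.Subgraph} {ℓ : ℕ}
    (h : IsCycleOfLength C ℓ) : C.verts.ncard = ℓ := by
  classical
  obtain ⟨u, w, hw, rfl, rfl⟩ := h
  have : w.toSubgraph.verts = (w.support.tail.toFinset : Set V) := by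
    ext v
    have hu : u ∈ w.support.tail := SimpleGraph.Walk.end_mem_tail_support hw.not_nil
    rw [SimpleGraph.Walk.mem_verts_toSubgraph, SimpleGraph.Walk.mem_support_iff]
    simp only [List.coe_toFinset, Set.mem_ofPred_eq]
    exact ⟨fun h => h.elim (fun h => h ▸ hu) id, Or.inr⟩
  rw [this, Set.ncard_coe_finset, List.toFinset_card_of_nodup hw.support_nodup]
  simp

theorem IsCycleOfLength.ncard_neighborSet {V : Type*} {Γ : SimpleGraph V} {C : Γ.Subgraph} {ℓ : ℕ}
    (h : IsCycleOfLength C ℓ) {v : V} (hv : v ∈ C.verts) : (C.neighborSet v).ncard = 2 := by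
  obtain ⟨u, w, hw, rfl, rfl⟩ := h
  exact hw.ncard_neighborSet_toSubgraph_eq_two ((w.mem_verts_toSubgraph).1 hv)

/-- In `ℤ/N`, a subgroup of order divisible by `n` contains the `n`-torsion. -/
theorem mem_of_dvd_card {N : ℕ} [NeZero N] (S : AddSubgroup (ZMod N)) {n : ℕ} {x : ZMod N}
    (hn : n ∣ Nat.card S) (hx : n • x = 0) : x ∈ S := by
  classical
  have hpos : 0 < Nat.card S := Nat.card_pos
  -- A cyclic group has at most `|S|` elements killed by `|S|`, and those of `S` are such, so `S` is
  -- all of them.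
  have hle := IsAddCyclic.card_nsmul_eq_zero_le (α := ZMod N) hpos
  have hsub : (S : Set (ZMod N)).toFinset ⊆
      Finset.univ.filter fun y : ZMod N => Nat.card S • y = 0 := by
    intro y hy
    rw [Set.mem_toFinset] at hy
    exact Finset.mem_filter.2 ⟨Finset.mem_univ _,
      congrArg Subtype.val (card_nsmul_eq_zero' (x := (⟨y, hy⟩ : S)))⟩
  have heq := Finset.eq_of_subset_of_card_le hsub (by
    rw [Set.toFinset_card, ← Nat.card_eq_fintype_card]
    exact hle)
  have hmem : x ∈ (S : Set (ZMod N)).toFinset := by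
    obtain ⟨c, hc⟩ := hn
    rw [heq, Finset.mem_filter, hc, mul_comm, mul_nsmul', hx]
    exact ⟨Finset.mem_univ _, smul_zero c⟩
  simpa using hmem

variable {m n : ℕ}

theorem mem_verts_map_translation {C : (multipartite m n).Subgraph} {g x : ZMod (m * n)} :
    x ∈ (C.map (translation m n g)).verts ↔ x - g ∈ C.verts := by
  simp [translation, sub_eq_add_neg]

theorem map_translation_zero (C : (multipartite m n).Subgraph) :
    C.map (translation m n 0) = C := by
  have : translation m n 0 = SimpleGraph.Hom.id := by
    ext x
    simp [translation]
  rw [this, SimpleGraph.Subgraph.map_id]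

theorem map_translation_map (C : (multipartite m n).Subgraph) (g h : ZMod (m * n)) :
    (C.map (translation m n g)).map (translation m n h) = C.map (translation m n (g + h)) := by
  have : translation m n (g + h) = (translation m n h).comp (translation m n g) := by
    ext x
    simp [translation, add_assoc]
  rw [this, SimpleGraph.Subgraph.map_comp]

/-- The translate `F + g` of a set of subgraphs. -/
def translate (g : ZMod (m * n)) (F : Set (multipartite m n).Subgraph) :
    Set (multipartite m n).Subgraph :=
  (fun C => C.map (translation m n g)) '' F

theorem translate_zero (F : Set (multipartite m n).Subgraph) : translate 0 F = F := by
  simp [translate, map_translation_zero]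

theorem translate_add (g h : ZMod (m * n)) (F : Set (multipartite m n).Subgraph) :
    translate (g + h) F = translate h (translate g F) := by
  simp only [translate, Set.image_image, map_translation_map]

/-- The stabilizer of a set of subgraphs under translations. -/
def translationStabilizer (F : Set (multipartite m n).Subgraph) : AddSubgroup (ZMod (m * n)) where
  carrier := {g | translate g F = F}
  zero_mem' := translate_zero F
  add_mem' {g h} hg hh := by
    simp only [Set.mem_ofPred_eq] at hg hh ⊢
    rw [translate_add, hg, hh]
  neg_mem' {g} hg := by
    simp only [Set.mem_ofPred_eq] at hg ⊢
    conv_lhs => rw [← hg]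
    rw [← translate_add, add_neg_cancel, translate_zero]

theorem mem_translationStabilizer {F : Set (multipartite m n).Subgraph} {g : ZMod (m * n)} :
    g ∈ translationStabilizer F ↔ translate g F = F := Iff.rfl

theorem map_translation_mem {F : Set (multipartite m n).Subgraph} {g : ZMod (m * n)}
    (hg : g ∈ translationStabilizer F) {C : (multipartite m n).Subgraph} (hC : C ∈ F) :
    C.map (translation m n g) ∈ F := by
  rw [← mem_translationStabilizer.1 hg]
  exact ⟨C, hC, rfl⟩

/-- A member of a `2`-factor joining `0` to an element `x` of odd prime order is not stabilized
by `x`. -/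
theorem not_mem_translationStabilizer_of_adj {F : Set (multipartite m n).Subgraph}
    [NeZero (m * n)] (hF : IsTwoFactor F) (hlen : ∀ C ∈ F, IsCycleOfLength C 4) {p : ℕ}
    (hp : p.Prime) (hp2 : p ≠ 2) {x : ZMod (m * n)} (hpx : p • x = 0)
    {C : (multipartite m n).Subgraph} (hC : C ∈ F) (hadj : C.Adj 0 x) :
    x ∉ translationStabilizer F := by
  classical
  intro hx
  have : Fact p.Prime := ⟨hp⟩
  -- Both `C` and `C + x` belong to `F` and contain the vertex `x`.
  have hfix : C.map (translation m n x) = C :=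
    (hF.partition x).unique
      ⟨map_translation_mem hx hC, mem_verts_map_translation.2 (by simpa using hadj.fst_mem)⟩
      ⟨hC, hadj.snd_mem⟩
  have hmem : ∀ v, v ∈ C.verts ↔ v - x ∈ C.verts := fun v => by
    conv_lhs => rw [← hfix]
    exact mem_verts_map_translation
  let f : Equiv.Perm C.verts := (Equiv.addRight x).subtypePerm fun v => by
    simpa using hmem (v + x)
  have hf : ∀ k : ℕ, ∀ v : C.verts, ((f ^ k) v : ZMod (m * n)) = v + k • x := by
    intro k
    induction k with
    | zero => simp
    | succ k ih =>
      intro v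
      rw [pow_succ, Equiv.Perm.mul_apply, ih, succ_nsmul', ← add_assoc]
      rfl
  have hcard : Fintype.card C.verts = 4 := by
    rw [← Nat.card_eq_fintype_card, Nat.card_coe_set_eq, (hlen C hC).ncard_verts]
  -- A permutation of 4 points whose `p`-th power is the identity has a fixed point, since `p ∤ 4`;
  -- a nonzero translation has none.
  obtain ⟨v, hv⟩ := Equiv.Perm.exists_fixed_point_of_prime (p := p) (n := 1) (σ := f)
    (by
      rw [hcard]
      intro h
      exact hp2 ((Nat.prime_dvd_prime_iff_eq hp Nat.prime_two).1
        (hp.dvd_of_dvd_pow (show p ∣ 2 ^ 2 from h))))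
    (by
      ext v
      simp [hf, hpx])
  have := hf 1 v
  rw [pow_one, hv, one_nsmul, left_eq_add] at this
  exact hadj.ne this.symm

theorem ncard_twoFactor {F : Set (multipartite m n).Subgraph} [NeZero (m * n)]
    (hF : IsTwoFactor F) {ℓ : ℕ} (hlen : ∀ C ∈ F, IsCycleOfLength C ℓ) :
    Nat.card F * ℓ = m * n := by
  classical
  have : Fintype F := Fintype.ofFinite F
  have e : (Σ C : F, C.1.verts) ≃ ZMod (m * n) :=
    Equiv.ofBijective (fun x => x.2.1) ⟨by
      rintro ⟨⟨C, hC⟩, v, hv⟩ ⟨⟨D, hD⟩, w, hw⟩ h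
      obtain rfl : v = w := h
      obtain rfl : C = D := (hF.partition v).unique ⟨hC, hv⟩ ⟨hD, hw⟩
      rfl, fun v => by
      obtain ⟨C, ⟨hC, hv⟩, -⟩ := hF.partition v
      exact ⟨⟨⟨C, hC⟩, v, hv⟩, rfl⟩⟩
  have h := Nat.card_congr e
  rw [Nat.card_sigma, Nat.card_zmod] at h
  rw [Finset.sum_congr rfl fun C _ =>
    (Nat.card_coe_set_eq _).trans (hlen C.1 C.2).ncard_verts] at h
  simpa using h

/-- For odd `m`, no `2`-factor of `K_{m × 4}` consisting of `4`-cycles is invariant under `m`. -/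
theorem natCast_not_mem_translationStabilizer (hm : Odd m)
    {F : Set (multipartite m 4).Subgraph} (hF : IsTwoFactor F)
    (hlen : ∀ C ∈ F, IsCycleOfLength C 4) : (m : ZMod (m * 4)) ∉ translationStabilizer F := by
  classical
  intro hx
  have hm0 := hm.pos
  have : NeZero (m * 4) := ⟨by omega⟩
  have : Fintype F := Fintype.ofFinite F
  have hcard : Fintype.card F = m := by
    have := ncard_twoFactor hF hlen
    rw [Nat.card_eq_fintype_card] at this
    omega
  let f : Equiv.Perm F :=
    { toFun := fun C => ⟨_, map_translation_mem hx C.2⟩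
      invFun := fun C => ⟨_, map_translation_mem (neg_mem hx) C.2⟩
      left_inv := fun C => Subtype.ext (by simp [map_translation_map, map_translation_zero])
      right_inv := fun C => Subtype.ext (by simp [map_translation_map, map_translation_zero]) }
  have hf : ∀ k : ℕ, ∀ C : F,
      ((f ^ k) C).1 = C.1.map (translation m 4 (k • (m : ZMod (m * 4)))) := by
    intro k
    induction k with
    | zero => simp [map_translation_zero]
    | succ k ih =>
      intro C
      rw [pow_succ', Equiv.Perm.mul_apply, succ_nsmul, ← map_translation_map, ← ih]
      rfl
  have h4 : (4 : ℕ) • (m : ZMod (m * 4)) = 0 := by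
    rw [nsmul_eq_mul, ← Nat.cast_mul, ZMod.natCast_eq_zero_iff, mul_comm]
  -- The order of `f` divides 4 and the number of cycles is odd, so some cycle is fixed.
  obtain ⟨⟨C, hC⟩, hfix⟩ := Equiv.Perm.exists_fixed_point_of_prime (p := 2) (n := 2) (σ := f)
    (by rw [hcard]; exact hm.not_two_dvd_nat)
    (by
      ext C : 2
      rw [hf, show 2 ^ 2 = 4 from rfl, h4, map_translation_zero]
      rfl)
  replace hfix : C.map (translation m 4 m) = C := congrArg Subtype.val hfix
  have hstep : ∀ v ∈ C.verts, v + m ∈ C.verts := fun v hv => by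
    rw [← hfix]
    exact mem_verts_map_translation.2 (by simpa using hv)
  have hne : C.verts.Nonempty := by
    rw [← Set.ncard_pos, (hlen C hC).ncard_verts]
    norm_num
  obtain ⟨v, hv⟩ := hne
  have hmul : ∀ k : ℕ, v + k • (m : ZMod (m * 4)) ∈ C.verts := by
    intro k
    induction k with
    | zero => simpa
    | succ k ih => rw [succ_nsmul, ← add_assoc]; exact hstep _ ih
  have horder : addOrderOf (m : ZMod (m * 4)) = 4 := by
    rw [ZMod.addOrderOf_coe _ (by omega), Nat.gcd_comm, Nat.gcd_mul_right_right,
      Nat.mul_div_cancel_left _ hm0]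
  have hsub : (fun y => v + y) '' (AddSubgroup.zmultiples (m : ZMod (m * 4)) : Set _) ⊆ C.verts := by
    rintro _ ⟨y, hy, rfl⟩
    obtain ⟨k, rfl⟩ := mem_multiples_iff_mem_zmultiples.2 hy
    exact hmul k
  -- Both sets have 4 elements, so the cycle is a whole part and cannot contain an edge.
  have heq := Set.eq_of_subset_of_ncard_le hsub (by
    rw [(hlen C hC).ncard_verts, Set.ncard_image_of_injective _ (add_right_injective v),
      ← Nat.card_coe_set_eq]
    exact (horder.symm.trans (Nat.card_zmultiples _).symm).le)
  obtain ⟨y, hy⟩ : (C.neighborSet v).Nonempty := by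
    rw [← Set.ncard_pos, (hlen C hC).ncard_neighborSet hv]
    norm_num
  have hyv : y ∈ C.verts := SimpleGraph.Subgraph.Adj.snd_mem hy
  rw [← heq] at hyv
  obtain ⟨d, hd, rfl⟩ := hyv
  have := C.adj_sub hy
  simp only [multipartite, sub_add_cancel_left, neg_mem_iff] at this
  exact this hd

/-- The stabilizer of a member of a cyclic `2`-factorization has at least three elements. -/
theorem two_lt_card_translationStabilizer [NeZero (m * n)]
    {𝓕 : Set (Set (multipartite m n).Subgraph)} (h𝓕 : IsTwoFactorization 𝓕)
    (hcyc : IsCyclicFamily 𝓕) {F : Set (multipartite m n).Subgraph} (hF : F ∈ 𝓕) :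
    2 < Nat.card (translationStabilizer F) := by
  classical
  by_contra! hle
  let O : Finset (Set (multipartite m n).Subgraph) := Finset.univ.image fun g => translate g F
  have hO : Fintype.card (ZMod (m * n)) ≤ 2 * O.card := by
    refine Finset.card_le_mul_card_image _ _ ?_
    intro F' hF'
    obtain ⟨h, -, rfl⟩ := Finset.mem_image.1 hF'
    refine le_trans ?_ hle
    rw [Nat.card_eq_fintype_card, ← Finset.card_univ]
    refine Finset.card_le_card_of_injOn
      (fun g => if hg : g - h ∈ translationStabilizer F then ⟨g - h, hg⟩ else 0)
      (fun _ _ => Finset.mem_coe.2 (Finset.mem_univ _)) ?_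
    have hmem : ∀ g, translate g F = translate h F → g - h ∈ translationStabilizer F := by
      intro g hg
      rw [mem_translationStabilizer, sub_eq_add_neg, translate_add, hg, ← translate_add,
        add_neg_cancel, translate_zero]
    intro g hg g' hg' hgg
    simp only [Finset.coe_filter, Finset.mem_univ, true_and, Set.mem_ofPred_eq] at hg hg'
    simpa [hmem g hg, hmem g' hg'] using hgg
  have hmem : ∀ F' ∈ O, F' ∈ 𝓕 := by
    intro F' hF'
    obtain ⟨h, -, rfl⟩ := Finset.mem_image.1 hF'
    exact hcyc F hF h
  let N : Set (multipartite m n).Subgraph → Finset (ZMod (m * n)) := fun F' =>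
    Finset.univ.filter fun y => ∃ C ∈ F', C.Adj 0 y
  have hN : ∀ F' ∈ O, 2 ≤ (N F').card := by
    intro F' hF'
    have htf := h𝓕.isTwoFactor F' (hmem F' hF')
    obtain ⟨C, ⟨hC, h0⟩, -⟩ := htf.partition 0
    obtain ⟨ℓ, hℓ⟩ := htf.isCycle C hC
    rw [← hℓ.ncard_neighborSet h0, ← Set.ncard_coe_finset]
    refine Set.ncard_le_ncard ?_
    intro y hy
    simpa [N] using ⟨C, hC, hy⟩
  have hdisj : (O : Set (Set (multipartite m n).Subgraph)).PairwiseDisjoint N := by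
    intro F₁ h₁ F₂ h₂ hne
    refine Finset.disjoint_left.2 fun y hy₁ hy₂ => hne ?_
    simp only [N, Finset.mem_filter, Finset.mem_univ, true_and] at hy₁ hy₂
    obtain ⟨C₁, hC₁, ha₁⟩ := hy₁
    obtain ⟨C₂, hC₂, ha₂⟩ := hy₂
    exact (h𝓕.edge s(0, y) (C₁.adj_sub ha₁)).unique ⟨hmem _ h₁, C₁, hC₁, ha₁⟩
      ⟨hmem _ h₂, C₂, hC₂, ha₂⟩
  -- The vertex `0` is not its own neighbour, which makes the bound strict.
  have hlt : (O.biUnion N).card < Fintype.card (ZMod (m * n)) := by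
    refine Finset.card_lt_univ_of_notMem (x := 0) ?_
    intro h
    obtain ⟨F', -, h0⟩ := Finset.mem_biUnion.1 h
    simp only [N, Finset.mem_filter] at h0
    obtain ⟨-, C, -, h0⟩ := h0
    exact h0.ne rfl
  rw [Finset.card_biUnion hdisj] at hlt
  have := Finset.card_nsmul_le_sum O (fun F' => (N F').card) 2 hN
  rw [smul_eq_mul] at this
  omega

theorem not_exists_cyclic_of_isPrimePow (hodd : Odd m) (hpp : IsPrimePow m) :
    ¬ ∃ 𝓕 : Set (Set (multipartite m 4).Subgraph),
      IsCycleFactorization 𝓕 4 ∧ IsCyclicFamily 𝓕 := by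
  rintro ⟨𝓕, h𝓕, hcyc⟩
  obtain ⟨p, α, hp, hα, rfl⟩ := (isPrimePow_nat_iff m).1 hpp
  have hppos := hp.pos
  have hm0 := hodd.pos
  have : NeZero (p ^ α * 4) := ⟨by omega⟩
  obtain ⟨β, rfl⟩ : ∃ β, α = β + 1 := ⟨α - 1, by omega⟩
  have hp2 : p ≠ 2 := by
    rintro rfl
    exact absurd hodd (by simp [Nat.even_pow, parity_simps])
  have hcop : p.Coprime 4 :=
    Nat.Coprime.pow_right 2 ((Nat.coprime_primes hp Nat.prime_two).2 hp2)
  -- This element has order `p`; it is outside the part of `0`, whose elements are killed by 4.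
  let x : ZMod (p ^ (β + 1) * 4) := ((4 * p ^ β : ℕ) : ZMod (p ^ (β + 1) * 4))
  have hpx : p • x = 0 := by
    simp only [x]
    rw [nsmul_eq_mul, ← Nat.cast_mul, ZMod.natCast_eq_zero_iff]
    exact ⟨1, by ring⟩
  have hadj : (multipartite (p ^ (β + 1)) 4).Adj 0 x := by
    intro h
    rw [zero_sub, neg_mem_iff, AddSubgroup.mem_zmultiples_iff] at h
    obtain ⟨k, hk⟩ := h
    have h4 : (4 : ℕ) • x = 0 := by
      rw [← hk, smul_comm]
      have : (4 : ℕ) • ((p ^ (β + 1) : ℕ) : ZMod (p ^ (β + 1) * 4)) = 0 := by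
        rw [nsmul_eq_mul, ← Nat.cast_mul, ZMod.natCast_eq_zero_iff, mul_comm]
      rw [this, smul_zero]
    simp only [x] at h4
    rw [nsmul_eq_mul, ← Nat.cast_mul, ZMod.natCast_eq_zero_iff] at h4
    have : p ^ β * p ∣ p ^ β * 4 := by
      refine Nat.dvd_of_mul_dvd_mul_right (k := 4) (by norm_num) ?_
      rw [← pow_succ]
      exact h4.trans ⟨1, by ring⟩
    have := Nat.dvd_of_mul_dvd_mul_left (pow_pos hppos β) this
    exact hp.one_lt.ne' (Nat.eq_one_of_dvd_coprimes hcop dvd_rfl this)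
  obtain ⟨F, ⟨hF, C, hC, hCx⟩, -⟩ := h𝓕.edge s(0, x) hadj
  have hlen := h𝓕.length_eq F hF
  have htf := h𝓕.isTwoFactor F hF
  have hx := not_mem_translationStabilizer_of_adj htf hlen hp hp2 hpx hC hCx
  have hmS := natCast_not_mem_translationStabilizer hodd htf hlen
  have hbig := two_lt_card_translationStabilizer h𝓕.toIsTwoFactorization hcyc hF
  set S := translationStabilizer F
  have hSp : ¬ p ∣ Nat.card S := fun h => hx (mem_of_dvd_card S h hpx)
  have hS4 : ¬ 4 ∣ Nat.card S := fun h => hmS (mem_of_dvd_card S h (by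
    rw [nsmul_eq_mul, ← Nat.cast_mul, ZMod.natCast_eq_zero_iff, mul_comm]))
  have hdvd : Nat.card S ∣ p ^ (β + 1) * 4 := by
    simpa using S.card_addSubgroup_dvd_card
  have hdvd4 : Nat.card S ∣ 4 := Nat.Coprime.dvd_of_dvd_mul_left
    (((Nat.Prime.coprime_iff_not_dvd hp).2 hSp).symm.pow_right _) hdvd
  have := Nat.le_of_dvd (by norm_num) hdvd4
  interval_cases h : Nat.card S
  · norm_num at hdvd4
  · exact hS4 dvd_rfl

end Nonexistence

end CyclicFactorization

theorem mainTheorem4 (m : ℕ) (hm : 1 < m) (hodd : Odd m) :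
    (∃ 𝓕 : Set (Set (CyclicFactorization.multipartite m 4).Subgraph),
      CyclicFactorization.IsCycleFactorization 𝓕 4 ∧ CyclicFactorization.IsCyclicFamily 𝓕) ↔
      ¬ IsPrimePow m :=
  ⟨fun h hpp => CyclicFactorization.not_exists_cyclic_of_isPrimePow hodd hpp h,
    CyclicFactorization.exists_cyclic_of_not_isPrimePow hm hodd⟩
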